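/- Let $(M,g)$ be a complete, noncompact, connected smooth Riemannian manifold with a pole $x_0\in M$, i.e. the cut locus of $x_0$ is empty: the exponential map $\exp_{x_0}:T_{x_0}M\to M$ is defined on all of $T_{x_0}M$ and is a diffeomorphism. Let $r(x)=\operatorname{dist}(x,x_0)$, let $B_{\bar R}=\{x\in M: r(x)<\bar R\}$, let $\Delta$ be the Laplace–Beltrami operator, and suppose that $\Delta r(x)\ge 0$ for every $x\in M\setminus\{x_0\}$. Let $V\in C^1(M)$ and suppose that there are $\bar R>0$, $c_0>0$ and $\alpha>0$ such that $V(x)\ge c_0\, r(x)^{\alpha}$ for all $x\in M\setminus B_{\bar R}$. Set $$a_0:=\frac{2\sqrt{c_0}}{\alpha+2}.$$ Then the function $$z(x)=\exp\{-a_0\, r(x)^{\frac{\alpha}{2}+1}\}$$ is a classical supersolution of $\Delta z-Vz=0$ in $M\setminus B_{\bar R}$; that is, $z$ is of class $C^2$ at every point of $M\setminus B_{\bar R}$, and $\Delta z(x)-V(x)z(x)\le 0$ there. -/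

import Mathlib

open Bundle Manifold
open scoped ContDiff

/-!
Riemannian geometry of a smooth `n`-dimensional manifold `M`, written in local coordinates.
A coordinate system is an element `e : OpenPartialHomeomorph M (EuclideanSpace ℝ (Fin n))` of the
(maximal) atlas of `M`; the Riemannian metric is the inner product on the tangent spaces.
-/

noncomputable section

namespace RiemannianPole

/-- The partial derivative `∂f/∂yⁱ` at the point `y` of a real function on `ℝⁿ`. -/
def partialDeriv {n : ℕ} (i : Fin n) (f : EuclideanSpace ℝ (Fin n) → ℝ)
    (y : EuclideanSpace ℝ (Fin n)) : ℝ :=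
  fderiv ℝ f y (EuclideanSpace.single i 1)

section Metric

variable {n : ℕ} {M : Type*} [TopologicalSpace M] [ChartedSpace (EuclideanSpace ℝ (Fin n)) M]
  [RiemannianBundle (fun x : M => TangentSpace (𝓡 n) x)]

/-- The coordinate vector field `∂/∂xⁱ` of the coordinate system `e`, at the point of `M` with
coordinates `y`. -/
def coordVector (e : OpenPartialHomeomorph M (EuclideanSpace ℝ (Fin n)))
    (y : EuclideanSpace ℝ (Fin n)) (i : Fin n) : TangentSpace (𝓡 n) (e.symm y) :=
  mfderiv (𝓡 n) (𝓡 n) e.symm y (EuclideanSpace.single i (1 : ℝ))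

/-- The matrix `(g_ij)` of the Riemannian metric in the coordinate system `e`, as a function of the
coordinates `y ∈ e.target`. -/
def metricMatrix (e : OpenPartialHomeomorph M (EuclideanSpace ℝ (Fin n)))
    (y : EuclideanSpace ℝ (Fin n)) : Matrix (Fin n) (Fin n) ℝ :=
  Matrix.of fun i j => inner ℝ (coordVector e y i) (coordVector e y j)

/-- The Laplace-Beltrami operator in the coordinate system `e`,
`Δu = (det g)^(-1/2) ∂_i ((det g)^(1/2) g^{ij} ∂_j u)`, at the point with coordinates `y`. -/
def laplacianInCoords (e : OpenPartialHomeomorph M (EuclideanSpace ℝ (Fin n))) (u : M → ℝ)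
    (y : EuclideanSpace ℝ (Fin n)) : ℝ :=
  (Real.sqrt (metricMatrix e y).det)⁻¹ *
    ∑ i, partialDeriv i (fun p => Real.sqrt (metricMatrix e p).det *
      ∑ j, (metricMatrix e p)⁻¹ i j * partialDeriv j (fun q => u (e.symm q)) p) y

/-- The Laplace-Beltrami operator `Δu` at `x`, computed in the preferred chart at `x`
(for `u` of class `C²` near `x` the choice of the chart is irrelevant). -/
def laplaceBeltrami (u : M → ℝ) (x : M) : ℝ :=
  laplacianInCoords (chartAt (EuclideanSpace ℝ (Fin n)) x) u
    (chartAt (EuclideanSpace ℝ (Fin n)) x x)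

/-- The Christoffel symbol `Γ^k_ij = ½ g^{kl} (∂_i g_jl + ∂_j g_il - ∂_l g_ij)` of the Levi-Civita
connection in the coordinate system `e`. -/
def christoffel (e : OpenPartialHomeomorph M (EuclideanSpace ℝ (Fin n)))
    (y : EuclideanSpace ℝ (Fin n)) (k i j : Fin n) : ℝ :=
  (1 / 2) * ∑ l, (metricMatrix e y)⁻¹ k l *
    (partialDeriv i (fun p => metricMatrix e p j l) y
      + partialDeriv j (fun p => metricMatrix e p i l) y
      - partialDeriv l (fun p => metricMatrix e p i j) y)

/-- `γ : ℝ → M` is a geodesic of the Riemannian manifold `M`: it is smooth, and in every local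
coordinate system of `M` it satisfies `γ̈^k + Γ^k_ij γ̇^i γ̇^j = 0`. -/
def IsGeodesic (γ : ℝ → M) : Prop :=
  ContMDiff 𝓘(ℝ, ℝ) (𝓡 n) ∞ γ ∧
    ∀ e ∈ IsManifold.maximalAtlas (𝓡 n) ∞ M, ∀ t : ℝ, γ t ∈ e.source → ∀ k : Fin n,
      deriv (deriv fun s => e (γ s) k) t
        + ∑ i, ∑ j, christoffel e (e (γ t)) k i j
            * deriv (fun s => e (γ s) i) t * deriv (fun s => e (γ s) j) t = 0

/-- `F` is the exponential map `exp_{x₀} : T_{x₀}M → M`: for every `v ∈ T_{x₀}M`, the curve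
`t ↦ F (t v)` is the geodesic that starts at `x₀` with velocity `v`. The tangent space `T_{x₀}M` is
the vector space `EuclideanSpace ℝ (Fin n)`, by the definition of `TangentSpace` (the norm of the
latter, which is not the Riemannian one, plays no role here). -/
def IsExpMap (x₀ : M) (F : EuclideanSpace ℝ (Fin n) → M) : Prop :=
  F 0 = x₀ ∧ ∀ v : EuclideanSpace ℝ (Fin n),
    IsGeodesic (n := n) (fun t : ℝ => F (t • v)) ∧
    mfderiv 𝓘(ℝ, ℝ) (𝓡 n) (fun t : ℝ => F (t • v)) 0 (1 : ℝ) = v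

/-- `x₀` is a pole of `M`: the exponential map at `x₀` is defined on the whole tangent space
and is a diffeomorphism of `T_{x₀}M` onto `M`. On a complete manifold this says that the cut
locus of `x₀` is empty, i.e. that the normal coordinates centred at `x₀` (and so the polar ones, away
from `x₀`) are defined globally. -/
def IsPole (x₀ : M) : Prop :=
  ∃ Φ : Diffeomorph (𝓡 n) (𝓡 n) (EuclideanSpace ℝ (Fin n)) M ∞, IsExpMap (n := n) x₀ Φ

/-- `z` is a (classical) supersolution of `Δz - V z = 0` in `S`: it is of class `C²` at the points
of `S` and satisfies `Δz - V z ≤ 0` there. -/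
def IsSupersolutionOn (V : M → ℝ) (S : Set M) (z : M → ℝ) : Prop :=
  ∀ x ∈ S, ContMDiffAt (𝓡 n) 𝓘(ℝ, ℝ) 2 z x ∧ laplaceBeltrami (n := n) z x - V x * z x ≤ 0

end Metric

end RiemannianPole

end

/-! Write `z = f(r)` with `f(s) = exp(-a s^β)` and `β = α/2 + 1`. The chain rule gives `Δz =
f''(r)|∇r|² + f'(r)Δr`. The last term is nonpositive, because `f' < 0` and `Δr ≥ 0`. Since `aβ =
√c₀`, `f''(s) = (c₀ s^α - √c₀ (β - 1) s^(β - 2)) f(s)`. The subtracted part has a favourable sign,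
so `0 ≤ |∇r|² ≤ 1` yields `Δz ≤ c₀ r^α z ≤ V z`. Only this bound on the gradient is needed, not
`|∇r| = 1`.

The geometric content is that `r` is smooth away from the pole with `|∇r| ≤ 1`. In the global normal
coordinates, the rays being geodesics implies the Gauss lemma (`gauss_lemma`). Let `Q(Φ v)` be the
squared length of `v` for the metric at the origin. The Gauss lemma and Cauchy–Schwarz give `|dQ| ≤
2√Q`. Rays then show `r ≤ √Q`, and integrating `d√Q` along arbitrary paths shows `√Q ≤ r`; hence `r²
= Q` is smooth (`contMDiff_dist_sq_of_isPole`). -/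

namespace RiemannianPole

/-! ### The metric in local coordinates -/

section Local

variable {n : ℕ} {M : Type*} [TopologicalSpace M] [ChartedSpace (EuclideanSpace ℝ (Fin n)) M]
  [RiemannianBundle (fun x : M => TangentSpace (𝓡 n) x)]

theorem euclidean_eq_sum_single (u : EuclideanSpace ℝ (Fin n)) :
    u = ∑ i, u i • EuclideanSpace.single i (1 : ℝ) := by
  ext j
  simp [Pi.single_apply]

theorem fderiv_eq_sum_partialDeriv (f : EuclideanSpace ℝ (Fin n) → ℝ)
    (y u : EuclideanSpace ℝ (Fin n)) :
    fderiv ℝ f y u = ∑ i, u i * partialDeriv i f y := by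
  conv_lhs => rw [euclidean_eq_sum_single u]
  simp [partialDeriv]

theorem sum_metricMatrix_eq_inner (e : OpenPartialHomeomorph M (EuclideanSpace ℝ (Fin n)))
    (y u w : EuclideanSpace ℝ (Fin n)) :
    ∑ i, ∑ j, metricMatrix e y i j * (u i * w j) =
      inner ℝ (mfderiv (𝓡 n) (𝓡 n) e.symm y u) (mfderiv (𝓡 n) (𝓡 n) e.symm y w) := by
  have key : ∀ u : EuclideanSpace ℝ (Fin n), mfderiv (𝓡 n) (𝓡 n) e.symm y u =
      ∑ i, u i • coordVector e y i := by
    intro u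
    conv_lhs => rw [euclidean_eq_sum_single u]
    erw [map_sum]
    refine Finset.sum_congr rfl fun i _ => ?_
    exact map_smul (mfderiv (𝓡 n) (𝓡 n) e.symm y) (u i) (EuclideanSpace.single i (1 : ℝ))
  rw [key u, key w]
  simp only [sum_inner, inner_sum, inner_smul_left, inner_smul_right, metricMatrix,
    Matrix.of_apply, conj_trivial]
  simp only [Finset.mul_sum]
  rw [Finset.sum_comm]
  refine Finset.sum_congr rfl fun i _ => Finset.sum_congr rfl fun j _ => by ring

theorem metricMatrix_comm (e : OpenPartialHomeomorph M (EuclideanSpace ℝ (Fin n)))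
    (y : EuclideanSpace ℝ (Fin n)) (i j : Fin n) :
    metricMatrix e y i j = metricMatrix e y j i := by
  simp only [metricMatrix, Matrix.of_apply]
  exact real_inner_comm _ _

omit [RiemannianBundle (fun x : M => TangentSpace (𝓡 n) x)] in
theorem mfderiv_symm_injective [IsManifold (𝓡 n) ∞ M]
    {e : OpenPartialHomeomorph M (EuclideanSpace ℝ (Fin n))}
    (he : e ∈ IsManifold.maximalAtlas (𝓡 n) ∞ M) {y : EuclideanSpace ℝ (Fin n)}
    (hy : y ∈ e.target) : Function.Injective (mfderiv (𝓡 n) (𝓡 n) e.symm y) := by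
  have hd : e.MDifferentiable (𝓡 n) (𝓡 n) :=
    ⟨(contMDiffOn_of_mem_maximalAtlas he).mdifferentiableOn (by simp),
      (contMDiffOn_symm_of_mem_maximalAtlas he).mdifferentiableOn (by simp)⟩
  exact hd.symm.mfderiv_injective hy

theorem posDef_metricMatrix [IsManifold (𝓡 n) ∞ M]
    {e : OpenPartialHomeomorph M (EuclideanSpace ℝ (Fin n))}
    (he : e ∈ IsManifold.maximalAtlas (𝓡 n) ∞ M) {y : EuclideanSpace ℝ (Fin n)}
    (hy : y ∈ e.target) : (metricMatrix e y).PosDef := by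
  refine Matrix.PosDef.of_dotProduct_mulVec_pos ?_ fun x hx => ?_
  · ext i j
    simpa using metricMatrix_comm e y j i
  · have h := sum_metricMatrix_eq_inner e y (WithLp.toLp 2 x) (WithLp.toLp 2 x)
    have h' : star x ⬝ᵥ (metricMatrix e y).mulVec x =
        ∑ i, ∑ j, metricMatrix e y i j * (x i * x j) := by
      simp only [dotProduct, Matrix.mulVec, Finset.mul_sum, star_trivial]
      refine Finset.sum_congr rfl fun i _ => Finset.sum_congr rfl fun j _ => by ring
    rw [h']
    refine h.symm ▸ real_inner_self_pos.2 fun h0 => hx ?_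
    have := mfderiv_symm_injective he hy (h0.trans (map_zero _).symm)
    exact congrArg WithLp.ofLp this

omit [RiemannianBundle (fun x : M => TangentSpace (𝓡 n) x)] in
-- The coordinate field is the tangent map of `e.symm` applied to a constant section, so it inherits
-- smoothness from the chart.
theorem contMDiffOn_coordVector [IsManifold (𝓡 n) ∞ M]
    {e : OpenPartialHomeomorph M (EuclideanSpace ℝ (Fin n))}
    (he : e ∈ IsManifold.maximalAtlas (𝓡 n) ∞ M) (i : Fin n) :
    ContMDiffOn (𝓡 n) (𝓡 n).tangent ∞
      (fun y => (⟨e.symm y, coordVector e y i⟩ : TangentBundle (𝓡 n) M)) e.target := by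
  have h1 : ContMDiffOn (𝓡 n).tangent (𝓡 n).tangent ∞
      (tangentMapWithin (𝓡 n) (𝓡 n) e.symm e.target)
      (Bundle.TotalSpace.proj ⁻¹' e.target) :=
    (contMDiffOn_symm_of_mem_maximalAtlas he).contMDiffOn_tangentMapWithin (by simp)
      e.open_target.uniqueMDiffOn
  have h2 : ContMDiff (𝓡 n) (𝓡 n).tangent ∞
      (fun y : EuclideanSpace ℝ (Fin n) => (⟨y, EuclideanSpace.single i (1 : ℝ)⟩ :
        TangentBundle (𝓡 n) (EuclideanSpace ℝ (Fin n)))) :=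
    contMDiff_vectorSpace_iff_contDiff.2 contDiff_const
  refine (h1.comp h2.contMDiffOn fun y hy => hy).congr fun y hy => ?_
  simp only [Function.comp, tangentMapWithin, coordVector]
  rw [mfderivWithin_of_isOpen e.open_target hy]

theorem contDiffOn_metricMatrix [IsManifold (𝓡 n) ∞ M]
    [IsContMDiffRiemannianBundle (𝓡 n) ∞ (EuclideanSpace ℝ (Fin n))
      (fun x : M => TangentSpace (𝓡 n) x)]
    {e : OpenPartialHomeomorph M (EuclideanSpace ℝ (Fin n))}
    (he : e ∈ IsManifold.maximalAtlas (𝓡 n) ∞ M) (i j : Fin n) :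
    ContDiffOn ℝ ∞ (fun y => metricMatrix e y i j) e.target := by
  rw [← contMDiffOn_iff_contDiffOn]
  exact ContMDiffOn.inner_bundle (contMDiffOn_coordVector he i) (contMDiffOn_coordVector he j)

end Local

end RiemannianPole

namespace RiemannianPole

/-! ### Determinants, inverses and dual norms -/

section MatrixCalculus

variable {n : ℕ} {E : Type*} [NormedAddCommGroup E] [NormedSpace ℝ E]

theorem differentiableAt_det {A : E → Matrix (Fin n) (Fin n) ℝ} {y : E}
    (hA : ∀ i j, DifferentiableAt ℝ (fun p => A p i j) y) :
    DifferentiableAt ℝ (fun p => (A p).det) y := by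
  simp only [Matrix.det_apply]
  refine DifferentiableAt.fun_sum fun σ _ => DifferentiableAt.const_smul ?_ _
  exact (HasFDerivAt.finsetProd fun i _ => (hA _ _).hasFDerivAt).differentiableAt

theorem differentiableAt_inv_apply {A : E → Matrix (Fin n) (Fin n) ℝ} {y : E}
    (hA : ∀ i j, DifferentiableAt ℝ (fun p => A p i j) y) (h0 : (A y).det ≠ 0) (i j : Fin n) :
    DifferentiableAt ℝ (fun p => (A p)⁻¹ i j) y := by
  simp only [Matrix.inv_def, Ring.inverse_eq_inv', Matrix.smul_apply, smul_eq_mul,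
    Matrix.adjugate_apply]
  refine ((differentiableAt_det hA).inv h0).mul (differentiableAt_det fun k l => ?_)
  by_cases hk : k = j
  · simp [Matrix.updateRow_apply, hk]
  · simpa [Matrix.updateRow_apply, hk] using hA k l

/-- The squared dual norm of a covector bounded by the norm of a positive definite form is at
most `1`. -/
theorem sum_inv_mul_mem_Icc {G : Matrix (Fin n) (Fin n) ℝ} (hG : G.PosDef) (a : Fin n → ℝ)
    (h : ∀ w : Fin n → ℝ, (∑ i, w i * a i) ^ 2 ≤ ∑ i, ∑ j, G i j * (w i * w j)) :
    ∑ i, a i * ∑ j, G⁻¹ i j * a j ∈ Set.Icc (0 : ℝ) 1 := by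
  -- Testing with the gradient `G⁻¹a` turns the hypothesis into `q² ≤ q` for `q = aᵀG⁻¹a`, which
  -- forces `0 ≤ q ≤ 1`.
  have hw := h (G⁻¹.mulVec a)
  have e1 : ∑ i, a i * ∑ j, G⁻¹ i j * a j = ∑ i, G⁻¹.mulVec a i * a i := by
    refine Finset.sum_congr rfl fun i _ => ?_
    rw [mul_comm]
    rfl
  have e2 : ∑ i, ∑ j, G i j * (G⁻¹.mulVec a i * G⁻¹.mulVec a j) = ∑ i, G⁻¹.mulVec a i * a i := by
    refine Finset.sum_congr rfl fun i _ => ?_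
    have : a i = ∑ j, G i j * G⁻¹.mulVec a j := by
      have h2 : G.mulVec (G⁻¹.mulVec a) = a := by
        rw [Matrix.mulVec_mulVec, Matrix.mul_nonsing_inv _ hG.det_pos.ne'.isUnit,
          Matrix.one_mulVec]
      exact (congrFun h2 i).symm
    conv_rhs => rw [this, Finset.mul_sum]
    exact Finset.sum_congr rfl fun j _ => by ring
  rw [e1]
  rw [e2] at hw
  exact ⟨(sq_nonneg _).trans hw, by nlinarith⟩

end MatrixCalculus

/-! ### Chain rule for the Laplacian -/

section Laplacian

variable {n : ℕ} {M : Type*} [TopologicalSpace M] [ChartedSpace (EuclideanSpace ℝ (Fin n)) M]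
  [RiemannianBundle (fun x : M => TangentSpace (𝓡 n) x)]

/-- The flux `√(det g) g^{ij} ∂_j` of `f ∘ u` is `f'(u)` times the flux `P` of `u`; the product rule
for its divergence gives the two terms. -/
theorem laplacianInCoords_comp [IsManifold (𝓡 n) ∞ M]
    [IsContMDiffRiemannianBundle (𝓡 n) ∞ (EuclideanSpace ℝ (Fin n))
      (fun x : M => TangentSpace (𝓡 n) x)]
    {e : OpenPartialHomeomorph M (EuclideanSpace ℝ (Fin n))}
    (he : e ∈ IsManifold.maximalAtlas (𝓡 n) ∞ M) {y : EuclideanSpace ℝ (Fin n)}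
    (hy : y ∈ e.target) {u : M → ℝ} (hu : ContDiffAt ℝ 2 (fun q => u (e.symm q)) y)
    {f : ℝ → ℝ} (hf : ContDiffAt ℝ 2 f (u (e.symm y))) :
    laplacianInCoords e (fun x => f (u x)) y =
      deriv (deriv f) (u (e.symm y)) * (∑ i, partialDeriv i (fun q => u (e.symm q)) y *
        ∑ j, (metricMatrix e y)⁻¹ i j * partialDeriv j (fun q => u (e.symm q)) y) +
      deriv f (u (e.symm y)) * laplacianInCoords e u y := by
  set U : EuclideanSpace ℝ (Fin n) → ℝ := fun q => u (e.symm q) with hU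
  set P : Fin n → EuclideanSpace ℝ (Fin n) → ℝ := fun i p => Real.sqrt (metricMatrix e p).det *
      ∑ j, (metricMatrix e p)⁻¹ i j * partialDeriv j U p with hP
  have hdet : 0 < (metricMatrix e y).det := (posDef_metricMatrix he hy).det_pos
  have hG : ∀ i j, DifferentiableAt ℝ (fun p => metricMatrix e p i j) y := fun i j =>
    ((contDiffOn_metricMatrix he i j).contDiffAt (e.open_target.mem_nhds hy)).differentiableAt
      (by simp)
  have hdU : ∀ j, DifferentiableAt ℝ (partialDeriv j U) y := fun j =>
    ((hu.fderiv_right (m := 1) (by norm_num)).differentiableAt one_ne_zero).clm_apply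
      (differentiableAt_const _)
  have hPd : ∀ i, DifferentiableAt ℝ (P i) y := fun i =>
    ((differentiableAt_det hG).sqrt hdet.ne').mul
      (DifferentiableAt.fun_sum fun j _ =>
        (differentiableAt_inv_apply hG hdet.ne' i j).mul (hdU j))
  have hUc : ContinuousAt U y := hu.continuousAt
  have hf1 : DifferentiableAt ℝ (deriv f) (U y) := by
    have := (hf.fderiv_right (m := 1) (by norm_num)).differentiableAt one_ne_zero
    exact this.clm_apply (differentiableAt_const (1 : ℝ))
  have hev : ∀ᶠ p in nhds y, DifferentiableAt ℝ U p ∧ DifferentiableAt ℝ f (U p) := by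
    refine Filter.Eventually.and ?_ (hUc.eventually ?_)
    · exact (hu.eventually (by simp)).mono fun p hp => hp.differentiableAt (by simp)
    · exact (hf.eventually (by simp)).mono fun p hp => hp.differentiableAt (by simp)
  -- The identity of fluxes is needed on a neighbourhood of `y`, since it is differentiated next.
  have hinner : ∀ i, (fun p => Real.sqrt (metricMatrix e p).det *
      ∑ j, (metricMatrix e p)⁻¹ i j * partialDeriv j (fun q => f (u (e.symm q))) p)
      =ᶠ[nhds y] fun p => deriv f (U p) * P i p := by
    intro i
    filter_upwards [hev] with p hp
    have h1 : ∀ j, partialDeriv j (fun q => f (u (e.symm q))) p =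
        deriv f (U p) * partialDeriv j U p := by
      intro j
      have := (hp.2.hasDerivAt.comp_hasFDerivAt p hp.1.hasFDerivAt).fderiv
      simp only [partialDeriv]
      erw [this]
      rfl
    simp only [h1, hP, Finset.mul_sum]
    exact Finset.sum_congr rfl fun j _ => by ring
  have houter : ∀ i, partialDeriv i (fun p => Real.sqrt (metricMatrix e p).det *
      ∑ j, (metricMatrix e p)⁻¹ i j * partialDeriv j (fun q => f (u (e.symm q))) p) y =
      deriv (deriv f) (U y) * partialDeriv i U y * P i y +
        deriv f (U y) * partialDeriv i (P i) y := by
    intro i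
    have hd := (hf1.hasDerivAt.comp_hasFDerivAt y (hu.differentiableAt (by simp)).hasFDerivAt).mul
      (hPd i).hasFDerivAt
    have h1 : partialDeriv i (fun p => deriv f (U p) * P i p) y =
        deriv (deriv f) (U y) * partialDeriv i U y * P i y +
          deriv f (U y) * partialDeriv i (P i) y := by
      have h2 : fderiv ℝ (fun p => deriv f (U p) * P i p) y = _ := hd.fderiv
      simp only [partialDeriv]
      rw [h2]
      simp
      ring
    rw [← h1]
    exact congrArg (fun L : EuclideanSpace ℝ (Fin n) →L[ℝ] ℝ => L (EuclideanSpace.single i 1)) (hinner i).fderiv_eq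
  have hs : Real.sqrt (metricMatrix e y).det ≠ 0 := (Real.sqrt_pos.2 hdet).ne'
  have hmain : laplacianInCoords e (fun x => f (u x)) y = (Real.sqrt (metricMatrix e y).det)⁻¹ *
      ∑ i, (deriv (deriv f) (U y) * partialDeriv i U y * P i y +
        deriv f (U y) * partialDeriv i (P i) y) := by
    simp only [laplacianInCoords, houter]
  have hL : laplacianInCoords e u y = (Real.sqrt (metricMatrix e y).det)⁻¹ *
      ∑ i, partialDeriv i (P i) y := rfl
  rw [hmain, hL, Finset.sum_add_distrib, mul_add]
  congr 1
  · rw [Finset.mul_sum, Finset.mul_sum]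
    refine Finset.sum_congr rfl fun i _ => ?_
    simp only [hP]
    field_simp
    simp only [hU]
    ring
  · rw [← Finset.mul_sum]
    ring

end Laplacian

end RiemannianPole

/-! ### The Gauss lemma -/

section Gauss

variable {E : Type*} [NormedAddCommGroup E] [NormedSpace ℝ E]

/-- The Gauss lemma in a global normal coordinate system, for a metric `B` such that the rays from
the origin solve the geodesic equation. -/
theorem gauss_lemma {B : E → E →L[ℝ] E →L[ℝ] ℝ} (hB : Differentiable ℝ B)
    (hsymm : ∀ y u w, B y u w = B y w u)
    (hgeo : ∀ (t : ℝ) (v u : E), 2 * fderiv ℝ B (t • v) v v u = fderiv ℝ B (t • v) u v v)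
    (t : ℝ) (v u : E) : B (t • v) v u = B 0 v u := by
  have hray : ∀ (v a b : E) (t : ℝ),
      HasDerivAt (fun t : ℝ => B (t • v) a b) (fderiv ℝ B (t • v) v a b) t := by
    intro v a b t
    have h1 : HasDerivAt (fun t : ℝ => t • v) v t := by
      simpa using (hasDerivAt_id t).smul_const v
    have h2 := HasFDerivAt.comp_hasDerivAt (l := B) (f := fun t : ℝ => t • v) t
      (hB (t • v)).hasFDerivAt h1
    have h3 := (h2.clm_apply (hasDerivAt_const t a)).clm_apply (hasDerivAt_const t b)
    simpa [Function.comp] using h3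
  -- Constant speed of rays: with `u = v`, `hgeo` reads `2X = X` for the derivative `X` of the
  -- squared speed.
  have hspeed : ∀ y : E, B y y y = B 0 y y := by
    intro y
    have h := is_const_of_deriv_eq_zero (fun t => (hray y y y t).differentiableAt)
      (fun t => by rw [(hray y y y t).deriv]; linarith [hgeo t y y]) 1 0
    simpa using h
  -- Differentiate `hspeed` in the direction `u`.
  have hpolar : ∀ y u : E, fderiv ℝ B y u y y + 2 * B y y u = 2 * B 0 y u := by
    intro y u
    have h1 : HasDerivAt (fun s : ℝ => y + s • u) u 0 := by
      simpa using ((hasDerivAt_id (0 : ℝ)).smul_const u).const_add y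
    have h2 : HasDerivAt (fun s : ℝ => B (y + s • u)) (fderiv ℝ B y u) 0 := by
      have := HasFDerivAt.comp_hasDerivAt (l := B) (f := fun s : ℝ => y + s • u) 0
        (hB (y + (0 : ℝ) • u)).hasFDerivAt h1
      simpa [Function.comp_def] using this
    have h3 := (h2.clm_apply h1).clm_apply h1
    have h4 := (((hasDerivAt_const (0 : ℝ) (B 0)).clm_apply h1).clm_apply h1)
    have h5 := h3.unique (by simpa only [hspeed] using h4)
    simp only [zero_smul, add_zero, add_apply,
      zero_apply, zero_add] at h5
    rw [hsymm y u y, hsymm 0 u y] at h5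
    linarith
  -- The factor `s` makes this function vanish at `0`. Its derivative is zero by `hpolar` at `s • v`
  -- combined with `hgeo`, after division by `s`.
  have hK : ∀ s : ℝ, HasDerivAt (fun s : ℝ => s * (B (s • v) v u - B 0 v u))
      (1 * (B (s • v) v u - B 0 v u) + s * fderiv ℝ B (s • v) v v u) s := fun s =>
    (hasDerivAt_id s).mul ((hray v v u s).sub_const _)
  have hK0 : ∀ s : ℝ, 1 * (B (s • v) v u - B 0 v u) + s * fderiv ℝ B (s • v) v v u = 0 := by
    intro s
    rcases eq_or_ne s 0 with rfl | hs
    · simp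
    · have h1 := hpolar (s • v) u
      have h2 := hgeo s v u
      simp only [map_smul, smul_apply, smul_eq_mul] at h1
      have : s * (1 * (B (s • v) v u - B 0 v u) + s * fderiv ℝ B (s • v) v v u) = 0 := by
        linear_combination (1 / 2) * h1 + s ^ 2 / 2 * h2
      exact (mul_eq_zero.1 this).resolve_left hs
  rcases eq_or_ne t 0 with rfl | ht
  · simp
  · have h := is_const_of_deriv_eq_zero (fun s => (hK s).differentiableAt)
      (fun s => (hK s).deriv.trans (hK0 s)) t 0
    simp only [zero_mul, mul_eq_zero, ht, false_or] at h
    linarith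

end Gauss

namespace RiemannianPole

theorem hasFDerivAt_sum_smul {ι E F : Type*} [Fintype ι] [NormedAddCommGroup E] [NormedSpace ℝ E]
    [NormedAddCommGroup F] [NormedSpace ℝ F] {g : E → ι → ι → ℝ} (c : ι → ι → F) {y : E}
    (hg : ∀ i j, DifferentiableAt ℝ (fun p => g p i j) y) :
    HasFDerivAt (fun p => ∑ i, ∑ j, g p i j • c i j)
      (∑ i, ∑ j, (fderiv ℝ (fun p => g p i j) y).smulRight (c i j)) y :=
  HasFDerivAt.fun_sum fun i _ => HasFDerivAt.fun_sum fun j _ => (hg i j).hasFDerivAt.smul_const _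

theorem fderiv_sum_smul_apply {ι E F : Type*} [Fintype ι] [NormedAddCommGroup E]
    [NormedSpace ℝ E] [NormedAddCommGroup F] [NormedSpace ℝ F] {g : E → ι → ι → ℝ}
    (c : ι → ι → F) {y : E} (hg : ∀ i j, DifferentiableAt ℝ (fun p => g p i j) y) (a : E) :
    fderiv ℝ (fun p => ∑ i, ∑ j, g p i j • c i j) y a =
      ∑ i, ∑ j, fderiv ℝ (fun p => g p i j) y a • c i j := by
  rw [(hasFDerivAt_sum_smul c hg).fderiv]
  simp [sum_apply]

/-! ### The metric as a bilinear form, and normal coordinates -/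

section MatrixForm

variable {n : ℕ} {E : Type*} [NormedAddCommGroup E] [NormedSpace ℝ E]

/-- The bilinear form `(u, w) ↦ ∑ i j, A i j * (ℓ i u * ℓ j w)`. -/
noncomputable def matrixForm (ℓ : Fin n → E →L[ℝ] ℝ) (A : Matrix (Fin n) (Fin n) ℝ) :
    E →L[ℝ] E →L[ℝ] ℝ :=
  ∑ i, ∑ j, A i j • (ℓ i).smulRight (ℓ j)

theorem matrixForm_apply (ℓ : Fin n → E →L[ℝ] ℝ) (A : Matrix (Fin n) (Fin n) ℝ) (u w : E) :
    matrixForm ℓ A u w = ∑ i, ∑ j, A i j * (ℓ i u * ℓ j w) := by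
  simp [matrixForm]

variable {G : E → Matrix (Fin n) (Fin n) ℝ} {y : E}

theorem differentiableAt_matrixForm (ℓ : Fin n → E →L[ℝ] ℝ)
    (hG : ∀ i j, DifferentiableAt ℝ (fun p => G p i j) y) :
    DifferentiableAt ℝ (fun p => matrixForm ℓ (G p)) y :=
  (hasFDerivAt_sum_smul (F := E →L[ℝ] E →L[ℝ] ℝ) (g := G) (y := y)
    (fun i j => (ℓ i).smulRight (ℓ j)) hG).differentiableAt

theorem fderiv_matrixForm_apply (ℓ : Fin n → E →L[ℝ] ℝ)
    (hG : ∀ i j, DifferentiableAt ℝ (fun p => G p i j) y) (a u w : E) :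
    fderiv ℝ (fun p => matrixForm ℓ (G p)) y a u w = ∑ i, ∑ j,
      fderiv ℝ (fun p => G p i j) y a * (ℓ i u * ℓ j w) := by
  have h : fderiv ℝ (fun p => matrixForm ℓ (G p)) y a = _ :=
    fderiv_sum_smul_apply (F := E →L[ℝ] E →L[ℝ] ℝ) (g := G) (y := y)
      (fun i j => (ℓ i).smulRight (ℓ j)) hG a
  rw [h]
  simp [sum_apply]

end MatrixForm

section NormalCoordinates

variable {n : ℕ} {M : Type*} [TopologicalSpace M] [ChartedSpace (EuclideanSpace ℝ (Fin n)) M]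
  [RiemannianBundle (fun x : M => TangentSpace (𝓡 n) x)]

theorem matrixForm_metricMatrix (e : OpenPartialHomeomorph M (EuclideanSpace ℝ (Fin n)))
    (y u w : EuclideanSpace ℝ (Fin n)) :
    matrixForm (fun i => EuclideanSpace.proj i) (metricMatrix e y) u w =
      inner ℝ (mfderiv (𝓡 n) (𝓡 n) e.symm y u) (mfderiv (𝓡 n) (𝓡 n) e.symm y w) := by
  rw [matrixForm_apply]
  exact sum_metricMatrix_eq_inner e y u w

variable [IsManifold (𝓡 n) ∞ M] [IsContMDiffRiemannianBundle (𝓡 n) ∞ (EuclideanSpace ℝ (Fin n))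
  (fun x : M => TangentSpace (𝓡 n) x)]

theorem differentiableAt_metricMatrix {e : OpenPartialHomeomorph M (EuclideanSpace ℝ (Fin n))}
    (he : e ∈ IsManifold.maximalAtlas (𝓡 n) ∞ M) {y : EuclideanSpace ℝ (Fin n)}
    (hy : y ∈ e.target) (i j : Fin n) :
    DifferentiableAt ℝ (fun p => metricMatrix e p i j) y :=
  ((contDiffOn_metricMatrix he i j).contDiffAt (e.open_target.mem_nhds hy)).differentiableAt
    (by simp)

/-- The geodesic equation `Γ^k_ij v^i v^j = 0`, with the index `k` lowered. -/
theorem two_mul_fderiv_matrixForm_eq {e : OpenPartialHomeomorph M (EuclideanSpace ℝ (Fin n))}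
    (he : e ∈ IsManifold.maximalAtlas (𝓡 n) ∞ M) {y : EuclideanSpace ℝ (Fin n)}
    (hy : y ∈ e.target) {v : EuclideanSpace ℝ (Fin n)}
    (hv : ∀ k, ∑ i, ∑ j, christoffel e y k i j * v i * v j = 0) (u : EuclideanSpace ℝ (Fin n)) :
    2 * fderiv ℝ (fun p => matrixForm (fun i => EuclideanSpace.proj i) (metricMatrix e p)) y v v u = fderiv ℝ (fun p => matrixForm (fun i => EuclideanSpace.proj i) (metricMatrix e p)) y u v v := by
  set T : Fin n → Fin n → Fin n → ℝ := fun k i j =>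
    partialDeriv k (fun p => metricMatrix e p i j) y with hT
  set c : Fin n → ℝ := fun l => ∑ i, ∑ j, (T i j l + T j i l - T l i j) * v i * v j with hc
  have hG := (posDef_metricMatrix he hy).det_pos.ne'.isUnit
  -- The contracted Christoffel symbols are `½ g⁻¹ c`, and `g⁻¹` is invertible.
  have hc0 : c = 0 := by
    have h1 : (metricMatrix e y)⁻¹.mulVec c = 0 := by
      ext k
      have h2 : ∑ i, ∑ j, christoffel e y k i j * v i * v j =
          (1 / 2) * (metricMatrix e y)⁻¹.mulVec c k := by
        simp only [christoffel, Matrix.mulVec, dotProduct, hc, Finset.mul_sum, Finset.sum_mul]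
        conv_rhs => rw [Finset.sum_comm]
        refine Finset.sum_congr rfl fun i _ => ?_
        rw [Finset.sum_comm]
        exact Finset.sum_congr rfl fun l _ => Finset.sum_congr rfl fun j _ => by ring
      rw [hv k] at h2
      simpa using h2.symm
    have h3 : (metricMatrix e y).mulVec ((metricMatrix e y)⁻¹.mulVec c) = c := by
      rw [Matrix.mulVec_mulVec, Matrix.mul_nonsing_inv _ hG, Matrix.one_mulVec]
    rw [← h3, h1, Matrix.mulVec_zero]
  have hsum : ∑ l, u l * c l = 0 := by simp [hc0]
  have hfd : ∀ a u w : EuclideanSpace ℝ (Fin n),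
      fderiv ℝ (fun p => matrixForm (fun i => EuclideanSpace.proj i) (metricMatrix e p)) y a u w =
        ∑ i, ∑ j, (∑ k, a k * T k i j) * (u i * w j) := by
    intro a u w
    refine (fderiv_matrixForm_apply _ (differentiableAt_metricMatrix he hy) a u w).trans ?_
    simp only [fderiv_eq_sum_partialDeriv]
    rfl
  have e1 : fderiv ℝ (fun p => matrixForm (fun i => EuclideanSpace.proj i) (metricMatrix e p)) y v v u = ∑ l, ∑ i, ∑ j, u l * (T i j l * v i * v j) := by
    rw [hfd, Finset.sum_comm]
    refine Finset.sum_congr rfl fun l _ => ?_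
    simp only [Finset.sum_mul]
    rw [Finset.sum_comm]
    exact Finset.sum_congr rfl fun i _ => Finset.sum_congr rfl fun j _ => by ring
  have e2 : fderiv ℝ (fun p => matrixForm (fun i => EuclideanSpace.proj i) (metricMatrix e p)) y v v u = ∑ l, ∑ i, ∑ j, u l * (T j i l * v i * v j) := by
    rw [e1]
    exact Finset.sum_congr rfl fun l _ => by
      rw [Finset.sum_comm]
      exact Finset.sum_congr rfl fun i _ => Finset.sum_congr rfl fun j _ => by ring
  have e3 : fderiv ℝ (fun p => matrixForm (fun i => EuclideanSpace.proj i) (metricMatrix e p)) y u v v = ∑ l, ∑ i, ∑ j, u l * (T l i j * v i * v j) := by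
    rw [hfd]
    simp only [Finset.sum_mul]
    conv_rhs => rw [Finset.sum_comm]
    refine Finset.sum_congr rfl fun i _ => ?_
    rw [Finset.sum_comm]
    exact Finset.sum_congr rfl fun l _ => Finset.sum_congr rfl fun j _ => by ring
  have e4 : ∑ l, u l * c l = ∑ l, ∑ i, ∑ j, u l * (T i j l * v i * v j) +
      ∑ l, ∑ i, ∑ j, u l * (T j i l * v i * v j) -
        ∑ l, ∑ i, ∑ j, u l * (T l i j * v i * v j) := by
    simp only [hc, Finset.mul_sum, ← Finset.sum_add_distrib, ← Finset.sum_sub_distrib]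
    exact Finset.sum_congr rfl fun l _ => Finset.sum_congr rfl fun i _ =>
      Finset.sum_congr rfl fun j _ => by ring
  rw [← e1, ← e2, ← e3, hsum] at e4
  linarith

/-- The Gauss lemma for the exponential map at a pole: the inner product of the radial vector `v`
with any other vector, transported along the ray of `v`, is constant. -/
theorem exists_inner_mfderiv_expMap_eq {x₀ : M}
    {Φ : Diffeomorph (𝓡 n) (𝓡 n) (EuclideanSpace ℝ (Fin n)) M ∞} (hΦ : IsExpMap (n := n) x₀ Φ) :
    ∃ S : EuclideanSpace ℝ (Fin n) →L[ℝ] EuclideanSpace ℝ (Fin n) →L[ℝ] ℝ,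
      ∀ (t : ℝ) (v u : EuclideanSpace ℝ (Fin n)),
        inner ℝ (mfderiv (𝓡 n) (𝓡 n) Φ (t • v) v) (mfderiv (𝓡 n) (𝓡 n) Φ (t • v) u) = S v u := by
  -- The inverse of the exponential map serves as one global chart. Rays are linear in it, so the
  -- second-derivative term of the geodesic equation vanishes.
  set e : OpenPartialHomeomorph M (EuclideanSpace ℝ (Fin n)) :=
    Φ.symm.toHomeomorph.toOpenPartialHomeomorph with he_def
  have he : e ∈ IsManifold.maximalAtlas (𝓡 n) ∞ M :=
    e.mem_maximalAtlas_of_contMDiffOn Φ.symm.contMDiff.contMDiffOn Φ.contMDiff.contMDiffOn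
  have hey : ∀ y, y ∈ e.target := fun y => Set.mem_univ y
  have heΦ : ∀ y, e (Φ y) = y := fun y => Φ.symm_apply_apply y
  refine ⟨matrixForm (fun i => EuclideanSpace.proj i) (metricMatrix e 0), fun t v u => ?_⟩
  have key := gauss_lemma (B := fun p => matrixForm (fun i => EuclideanSpace.proj i) (metricMatrix e p))
    (fun y => differentiableAt_matrixForm _ (differentiableAt_metricMatrix he (hey y)))
    (fun y u w => by rw [matrixForm_metricMatrix, matrixForm_metricMatrix]; exact real_inner_comm _ _)
    (fun t v u => two_mul_fderiv_matrixForm_eq he (hey _) (fun k => ?_) u) t v u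
  · rw [matrixForm_metricMatrix] at key
    exact key
  · have h := (hΦ.2 v).1.2 e he t (Set.mem_univ _) k
    simp only [heΦ] at h
    have hd : ∀ i, deriv (fun s : ℝ => (s • v) i) = fun _ => v i := by
      intro i
      ext s
      simp [PiLp.smul_apply]
    simpa [hd] using h

end NormalCoordinates

end RiemannianPole

namespace RiemannianPole

/-- The derivative of the real function `f` at `x` in the direction of the tangent vector `w`. -/
noncomputable def dirDeriv {n : ℕ} {M : Type*} [TopologicalSpace M]
    [ChartedSpace (EuclideanSpace ℝ (Fin n)) M] (f : M → ℝ) (x : M)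
    (w : TangentSpace (𝓡 n) x) : ℝ :=
  mfderiv (𝓡 n) 𝓘(ℝ, ℝ) f x w

/-! ### Riemannian distance and the distance to a pole -/

section Distance

open MeasureTheory

variable {n : ℕ} {M : Type*} [TopologicalSpace M] [ChartedSpace (EuclideanSpace ℝ (Fin n)) M]
  [RiemannianBundle (fun x : M => TangentSpace (𝓡 n) x)]

/-- A `C¹` function whose differential has norm at most `1` is `1`-Lipschitz for the Riemannian
distance. -/
theorem edist_le_riemannianEDist_of_abs_dirDeriv_le {F : M → ℝ}
    (hF : ContMDiff (𝓡 n) 𝓘(ℝ, ℝ) 1 F)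
    (h : ∀ (x : M) (w : TangentSpace (𝓡 n) x), |dirDeriv F x w| ≤ ‖w‖)
    (x y : M) : edist (F x) (F y) ≤ riemannianEDist (𝓡 n) x y := by
  refine le_of_forall_gt fun r hr => ?_
  -- Take a path of length below `r`; its image under `F` is no longer and joins `F x` to `F y`.
  obtain ⟨γ, h0, h1, hγ, hlt⟩ := exists_lt_of_riemannianEDist_lt hr
  refine lt_of_le_of_lt ?_ hlt
  rw [IsRiemannianManifold.out (I := 𝓘(ℝ, ℝ)) (F x) (F y)]
  refine (riemannianEDist_le_pathELength (I := 𝓘(ℝ, ℝ)) (γ := F ∘ γ) (a := 0) (b := 1)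
    (hF.comp_contMDiffOn hγ) (by simp [h0]) (by simp [h1]) zero_le_one).trans ?_
  rw [pathELength_eq_lintegral_mfderivWithin_Icc, pathELength_eq_lintegral_mfderivWithin_Icc]
  refine setLIntegral_mono' measurableSet_Icc fun t ht => ?_
  have hc : mfderivWithin 𝓘(ℝ, ℝ) 𝓘(ℝ, ℝ) (F ∘ γ) (Set.Icc 0 1) t =
      (mfderiv (𝓡 n) 𝓘(ℝ, ℝ) F (γ t)).comp
        (mfderivWithin 𝓘(ℝ, ℝ) (𝓡 n) γ (Set.Icc 0 1) t) :=
    mfderiv_comp_mfderivWithin t (hF.mdifferentiableAt one_ne_zero)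
      (hγ.mdifferentiableOn one_ne_zero t ht)
      (uniqueMDiffWithinAt_iff_uniqueDiffWithinAt.2 (uniqueDiffOn_Icc zero_lt_one t ht))
  rw [hc, ← ofReal_norm, ← ofReal_norm, norm_tangentSpace_vectorSpace]
  exact ENNReal.ofReal_le_ofReal (h _ _)

end Distance

section RadialDistance

variable {n : ℕ} {M : Type*} [MetricSpace M]
    [ChartedSpace (EuclideanSpace ℝ (Fin n)) M]
    [RiemannianBundle (fun x : M => TangentSpace (𝓡 n) x)]

/-- The ray `t ↦ Φ (t • v)` on `[0, 1]` has constant speed `c`, hence length `c`. -/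
theorem edist_le_of_norm_mfderiv_ray_eq [IsRiemannianManifold (𝓡 n) M]
    {Φ : EuclideanSpace ℝ (Fin n) → M}
    (hΦ : ContMDiff (𝓡 n) (𝓡 n) ∞ Φ) (v : EuclideanSpace ℝ (Fin n)) {c : ℝ}
    (hc : ∀ t : ℝ, ‖mfderiv (𝓡 n) (𝓡 n) Φ (t • v) v‖ = c) :
    edist (Φ 0) (Φ v) ≤ ENNReal.ofReal c := by
  have hlin : ContMDiff 𝓘(ℝ, ℝ) (𝓡 n) ∞ (fun t : ℝ => t • v) := by
    rw [contMDiff_iff_contDiff]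
    exact contDiff_id.smul contDiff_const
  rw [IsRiemannianManifold.out (I := 𝓡 n) (Φ 0) (Φ v)]
  refine (riemannianEDist_le_pathELength (I := 𝓡 n) (γ := Φ ∘ fun t : ℝ => t • v) (a := 0) (b := 1)
    ((hΦ.comp hlin).of_le (by simp)).contMDiffOn (by simp) (by simp) zero_le_one).trans ?_
  rw [pathELength_eq_lintegral_mfderiv_Icc]
  have hd : ∀ t : ℝ, ‖mfderiv 𝓘(ℝ, ℝ) (𝓡 n) (Φ ∘ fun t : ℝ => t • v) t 1‖ₑ = ENNReal.ofReal c := by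
    intro t
    rw [mfderiv_comp t (hΦ.mdifferentiableAt (by simp)) (hlin.mdifferentiableAt (by simp)),
      ← ofReal_norm, ← hc t]
    congr 2
    have : mfderiv 𝓘(ℝ, ℝ) (𝓡 n) (fun t : ℝ => t • v) t (1 : ℝ) = v := by
      rw [mfderiv_eq_fderiv]
      have : HasDerivAt (fun t : ℝ => t • v) v t := by
        simpa using (hasDerivAt_id t).smul_const v
      refine (congrArg (fun L : ℝ →L[ℝ] EuclideanSpace ℝ (Fin n) => L 1)
        this.hasFDerivAt.fderiv).trans ?_
      simp
    exact congrArg (mfderiv (𝓡 n) (𝓡 n) Φ (t • v)) this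
  simp [hd]

/-- Taking `δ > 0` smooths the square root at zeros of `Q`, as needed for the global Lipschitz
bound; `δ = 0` serves for `r` itself away from the pole. -/
theorem abs_dirDeriv_sqrt_le {Q : M → ℝ} (hQ : ContMDiff (𝓡 n) 𝓘(ℝ, ℝ) ∞ Q)
    (hdQ : ∀ (x : M) (w : TangentSpace (𝓡 n) x),
      |dirDeriv Q x w| ≤ 2 * Real.sqrt (Q x) * ‖w‖)
    {δ : ℝ} (hδ : 0 ≤ δ) {x : M} (hx : 0 < δ + Q x) (w : TangentSpace (𝓡 n) x) :
    |dirDeriv (fun x => Real.sqrt (δ + Q x)) x w| ≤ ‖w‖ := by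
  have hs : HasDerivAt (fun s : ℝ => Real.sqrt (δ + s)) (1 / (2 * Real.sqrt (δ + Q x))) (Q x) := by
    simpa using ((hasDerivAt_id (Q x)).const_add δ).sqrt hx.ne'
  have hd : dirDeriv (fun x => Real.sqrt (δ + Q x)) x w =
      dirDeriv Q x w * (1 / (2 * Real.sqrt (δ + Q x))) := by
    have := mfderiv_comp (I' := 𝓘(ℝ, ℝ)) x (hs.differentiableAt.mdifferentiableAt)
      (hQ.mdifferentiableAt (x := x) (by simp))
    have h2 : mfderiv (𝓡 n) 𝓘(ℝ, ℝ) (fun x => Real.sqrt (δ + Q x)) x = _ := this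
    rw [dirDeriv, h2, mfderiv_eq_fderiv, hs.hasFDerivAt.fderiv]
    rfl
  have hpos : 0 < Real.sqrt (δ + Q x) := Real.sqrt_pos.2 hx
  have hle : Real.sqrt (Q x) ≤ Real.sqrt (δ + Q x) := Real.sqrt_le_sqrt (by linarith)
  rw [hd, abs_mul, abs_of_pos (by positivity : 0 < 1 / (2 * Real.sqrt (δ + Q x))), mul_one_div,
    div_le_iff₀ (by positivity)]
  refine (hdQ x w).trans ?_
  have := mul_le_mul_of_nonneg_right hle (norm_nonneg w)
  linarith

variable [IsManifold (𝓡 n) ∞ M]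
    [IsContMDiffRiemannianBundle (𝓡 n) ∞ (EuclideanSpace ℝ (Fin n))
      (fun x : M => TangentSpace (𝓡 n) x)]
    [IsRiemannianManifold (𝓡 n) M]

/-- The squared distance to a pole is smooth, and its gradient at `x` has norm at most
`2 * dist x x₀`. -/
theorem contMDiff_dist_sq_of_isPole {x₀ : M} (hpole : IsPole (n := n) x₀) :
    ContMDiff (𝓡 n) 𝓘(ℝ, ℝ) ∞ (fun x => dist x x₀ ^ 2) ∧
    ∀ (x : M) (w : TangentSpace (𝓡 n) x),
      |dirDeriv (fun x => dist x x₀ ^ 2) x w| ≤ 2 * dist x x₀ * ‖w‖ := by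
  obtain ⟨Φ, hΦ⟩ := hpole
  obtain ⟨S, hS⟩ := exists_inner_mfderiv_expMap_eq hΦ
  have hS1 : ∀ v u, inner ℝ (mfderiv (𝓡 n) (𝓡 n) Φ v v) (mfderiv (𝓡 n) (𝓡 n) Φ v u) = S v u := by
    intro v u
    have := hS 1 v u
    rwa [one_smul] at this
  have hnorm : ∀ (t : ℝ) v, ‖mfderiv (𝓡 n) (𝓡 n) Φ (t • v) v‖ = Real.sqrt (S v v) := by
    intro t v
    rw [← hS t v v, real_inner_self_eq_norm_sq, Real.sqrt_sq (norm_nonneg _)]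
  have hsymm : ∀ v u, S v u = S u v := by
    intro v u
    have h1 := hS 0 v u
    have h2 := hS 0 u v
    rw [zero_smul] at h1 h2
    rw [← h1, ← h2]
    exact real_inner_comm _ _
  have hS0 : ∀ v, 0 ≤ S v v := fun v => by
    rw [← hS 1 v v]
    exact real_inner_self_nonneg
  set Q : M → ℝ := fun x => S (Φ.symm x) (Φ.symm x) with hQdef
  have hq : ∀ v, HasFDerivAt (fun v => S v v) ((2 : ℝ) • S v) v := by
    intro v
    have := (S.hasFDerivAt (x := v)).clm_apply (hasFDerivAt_id v)
    refine this.congr_fderiv ?_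
    ext u
    simp [hsymm u v]
    ring
  have hQ : ContMDiff (𝓡 n) 𝓘(ℝ, ℝ) ∞ Q := by
    have hqs : ContDiff ℝ ∞ (fun v => S v v) := S.contDiff.clm_apply contDiff_id
    exact hqs.contMDiff.comp Φ.symm.contMDiff
  have hdQ : ∀ (x : M) (w : TangentSpace (𝓡 n) x),
      |dirDeriv Q x w| ≤ 2 * Real.sqrt (Q x) * ‖w‖ := by
    intro x w
    obtain ⟨v, rfl⟩ : ∃ v, Φ v = x := Φ.surjective x
    have hQΦ : Q ∘ Φ = fun v => S v v := by
      ext v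
      simp [hQdef]
    have hcomp := mfderiv_comp (I' := 𝓡 n) v (hQ.mdifferentiableAt (by simp))
      (Φ.contMDiff.mdifferentiableAt (x := v) (by simp))
    rw [hQΦ, mfderiv_eq_fderiv, (hq v).fderiv] at hcomp
    -- Every tangent vector is `dΦ u`, so `dQ(w) = 2⟨dΦ v, dΦ u⟩` by the Gauss lemma, and
    -- Cauchy–Schwarz applies.
    obtain ⟨u, rfl⟩ : ∃ u, mfderiv (𝓡 n) (𝓡 n) Φ v u = w :=
      (Φ.toOpenPartialHomeomorph_mdifferentiable (by simp)).mfderiv_surjective (Set.mem_univ v) w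
    have h1 : dirDeriv Q (Φ v) (mfderiv (𝓡 n) (𝓡 n) Φ v u) = (2 : ℝ) * S v u :=
      (congrArg (fun L : EuclideanSpace ℝ (Fin n) →L[ℝ] ℝ => L u) hcomp).symm
    rw [h1, ← hS1, abs_mul, abs_two, mul_assoc]
    have h2 := abs_real_inner_le_norm (mfderiv (𝓡 n) (𝓡 n) Φ v v) (mfderiv (𝓡 n) (𝓡 n) Φ v u)
    have h3 : ‖mfderiv (𝓡 n) (𝓡 n) Φ v v‖ = Real.sqrt (Q (Φ v)) := by
      have := hnorm 1 v
      rw [one_smul] at this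
      rw [this]
      simp [hQdef]
    rw [h3] at h2
    linarith
  have hQ0 : ∀ x, 0 ≤ Q x := fun x => hS0 _
  have hx₀ : Q x₀ = 0 := by
    simp [hQdef, ← hΦ.1]
  have hupper : ∀ x, dist x x₀ ≤ Real.sqrt (Q x) := by
    intro x
    have h := edist_le_of_norm_mfderiv_ray_eq Φ.contMDiff (Φ.symm x) (fun t => hnorm t _)
    rw [hΦ.1, Φ.apply_symm_apply, edist_dist, ENNReal.ofReal_le_ofReal_iff (Real.sqrt_nonneg _)] at h
    rwa [dist_comm]
  -- `√Q` need not be differentiable at `x₀`, so the Lipschitz bound is applied to `√(ε² + Q)`,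
  -- whose value at `x₀` is `ε`.
  have hlower : ∀ x, Real.sqrt (Q x) ≤ dist x x₀ := by
    intro x
    refine le_of_forall_pos_le_add fun ε hε => ?_
    have hpos : ∀ x, 0 < ε ^ 2 + Q x := fun x => by have := hQ0 x; positivity
    have hF : ContMDiff (𝓡 n) 𝓘(ℝ, ℝ) 1 (fun x => Real.sqrt (ε ^ 2 + Q x)) := by
      intro z
      have h1 : ContDiffAt ℝ 1 (fun s : ℝ => Real.sqrt (ε ^ 2 + s)) (Q z) :=
        (contDiffAt_const.add contDiffAt_id).sqrt (hpos z).ne'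
      exact h1.contMDiffAt.comp z ((hQ z).of_le (by simp))
    have h := edist_le_riemannianEDist_of_abs_dirDeriv_le hF
      (fun z w => abs_dirDeriv_sqrt_le hQ hdQ (sq_nonneg ε) (hpos z) w) x x₀
    rw [← IsRiemannianManifold.out (I := 𝓡 n) x x₀, edist_dist, edist_dist,
      ENNReal.ofReal_le_ofReal_iff dist_nonneg, Real.dist_eq, hx₀, add_zero,
      Real.sqrt_sq hε.le] at h
    have h2 : Real.sqrt (Q x) ≤ Real.sqrt (ε ^ 2 + Q x) :=
      Real.sqrt_le_sqrt (by have := sq_nonneg ε; linarith)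
    have h3 := (abs_le.1 h).2
    linarith
  have heq : ∀ x, dist x x₀ = Real.sqrt (Q x) := fun x => le_antisymm (hupper x) (hlower x)
  have hfun : (fun x => dist x x₀ ^ 2) = Q := by
    ext x
    rw [heq, Real.sq_sqrt (hQ0 x)]
  refine ⟨hfun ▸ hQ, fun x w => ?_⟩
  rw [hfun, heq]
  exact hdQ x w

end RadialDistance

end RiemannianPole

namespace RiemannianPole

/-! ### The radial profile and the composed Laplacian -/

section Profile

theorem hasDerivAt_exp_neg_mul_rpow (a β : ℝ) {s : ℝ} (hs : 0 < s) :
    HasDerivAt (fun s : ℝ => Real.exp (-a * s ^ β))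
      (-(a * β) * s ^ (β - 1) * Real.exp (-a * s ^ β)) s := by
  have h := ((Real.hasDerivAt_rpow_const (p := β) (Or.inl hs.ne')).const_mul (-a)).exp
  exact h.congr_deriv (by ring)

theorem deriv_deriv_exp_neg_mul_rpow (a β : ℝ) {s : ℝ} (hs : 0 < s) :
    deriv (deriv fun s : ℝ => Real.exp (-a * s ^ β)) s =
      ((a * β) ^ 2 * s ^ (2 * (β - 1)) - a * β * (β - 1) * s ^ (β - 1 - 1)) *
        Real.exp (-a * s ^ β) := by
  have hev : (deriv fun s : ℝ => Real.exp (-a * s ^ β)) =ᶠ[nhds s]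
      fun s => -(a * β) * s ^ (β - 1) * Real.exp (-a * s ^ β) := by
    filter_upwards [lt_mem_nhds hs] with t ht using (hasDerivAt_exp_neg_mul_rpow a β ht).deriv
  have h := ((Real.hasDerivAt_rpow_const (p := β - 1) (Or.inl hs.ne')).const_mul (-(a * β))).mul
    (hasDerivAt_exp_neg_mul_rpow a β hs)
  have h2 : s ^ (2 * (β - 1)) = s ^ (β - 1) * s ^ (β - 1) := by
    rw [← Real.rpow_add hs]
    ring_nf
  rw [hev.deriv_eq, h2]
  exact h.deriv.trans (by ring)

theorem contDiffAt_exp_neg_mul_rpow (a β : ℝ) {s : ℝ} (hs : 0 < s) :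
    ContDiffAt ℝ 2 (fun s : ℝ => Real.exp (-a * s ^ β)) s :=
  (contDiffAt_const.mul (Real.contDiffAt_rpow_const_of_ne hs.ne')).exp

end Profile

section Comparison

variable {n : ℕ} {M : Type*} [TopologicalSpace M] [ChartedSpace (EuclideanSpace ℝ (Fin n)) M]
  [RiemannianBundle (fun x : M => TangentSpace (𝓡 n) x)] [IsManifold (𝓡 n) ∞ M]
  [IsContMDiffRiemannianBundle (𝓡 n) ∞ (EuclideanSpace ℝ (Fin n))
    (fun x : M => TangentSpace (𝓡 n) x)]

/-- `Δ(f ∘ u) = f''(u) |∇u|² + f'(u) Δu`, with `|∇u|² ≤ 1` if the differential of `u` has norm at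
most `1`. -/
theorem exists_laplaceBeltrami_comp_eq {u : M → ℝ} {x : M}
    (hu : ContMDiffAt (𝓡 n) 𝓘(ℝ, ℝ) 2 u x)
    (hdu : ∀ w : TangentSpace (𝓡 n) x, |dirDeriv u x w| ≤ ‖w‖)
    {f : ℝ → ℝ} (hf : ContDiffAt ℝ 2 f (u x)) :
    ∃ c ∈ Set.Icc (0 : ℝ) 1, laplaceBeltrami (n := n) (fun x => f (u x)) x =
      deriv (deriv f) (u x) * c + deriv f (u x) * laplaceBeltrami (n := n) u x := by
  set e := chartAt (EuclideanSpace ℝ (Fin n)) x with he_def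
  have he : e ∈ IsManifold.maximalAtlas (𝓡 n) ∞ M := IsManifold.chart_mem_maximalAtlas x
  have hy : e x ∈ e.target := mem_chart_target _ x
  have hx : e.symm (e x) = x := e.left_inv (mem_chart_source _ x)
  have hs : ContMDiffAt (𝓡 n) (𝓡 n) 2 e.symm (e x) :=
    (contMDiffAt_symm_of_mem_maximalAtlas he hy).of_le ENat.LEInfty.out
  have huU : ContDiffAt ℝ 2 (fun q => u (e.symm q)) (e x) := by
    rw [← hx] at hu
    exact (hu.comp (e x) hs).contDiffAt
  -- The witness is `|∇u|² = g^{ij} ∂_i u ∂_j u`, left to unification with the chain rule.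
  refine ⟨_, sum_inv_mul_mem_Icc (posDef_metricMatrix he hy)
    (fun i => partialDeriv i (fun q => u (e.symm q)) (e x)) fun w => ?_, ?_⟩
  · have h1 := sum_metricMatrix_eq_inner e (e x) (WithLp.toLp 2 w) (WithLp.toLp 2 w)
    have h2 := fderiv_eq_sum_partialDeriv (fun q => u (e.symm q)) (e x) (WithLp.toLp 2 w)
    have h3 : fderiv ℝ (fun q => u (e.symm q)) (e x) (WithLp.toLp 2 w) =
        dirDeriv u (e.symm (e x)) (mfderiv (𝓡 n) (𝓡 n) e.symm (e x) (WithLp.toLp 2 w)) := by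
      rw [← hx] at hu
      have := mfderiv_comp (e x) (hu.mdifferentiableAt (by simp)) (hs.mdifferentiableAt (by simp))
      rw [mfderiv_eq_fderiv] at this
      exact congrArg (fun L : EuclideanSpace ℝ (Fin n) →L[ℝ] ℝ => L (WithLp.toLp 2 w)) this
    have hdu' : ∀ w : TangentSpace (𝓡 n) (e.symm (e x)), |dirDeriv u (e.symm (e x)) w| ≤ ‖w‖ := by
      rw [hx]
      exact hdu
    refine le_of_eq_of_le (congrArg (· ^ 2) (h2.symm.trans h3)) (le_of_le_of_eq ?_ h1.symm)
    rw [real_inner_self_eq_norm_sq, sq_le_sq, abs_norm]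
    exact hdu' _
  · have h := laplacianInCoords_comp he hy huU (f := f) (by rwa [hx])
    rw [hx] at h
    exact h

end Comparison

end RiemannianPole

/-! ### The supersolution -/

theorem proposition6p3 {n : ℕ} {M : Type*} [MetricSpace M]
    [ChartedSpace (EuclideanSpace ℝ (Fin n)) M] [IsManifold (𝓡 n) ∞ M]
    [RiemannianBundle (fun x : M => TangentSpace (𝓡 n) x)]
    [IsContMDiffRiemannianBundle (𝓡 n) ∞ (EuclideanSpace ℝ (Fin n))
      (fun x : M => TangentSpace (𝓡 n) x)]
    [IsRiemannianManifold (𝓡 n) M]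
    [ConnectedSpace M] [CompleteSpace M] [NoncompactSpace M]
    (x₀ : M) (hpole : RiemannianPole.IsPole (n := n) x₀)
    (hr : ∀ x : M, x ≠ x₀ →
      0 ≤ RiemannianPole.laplaceBeltrami (n := n) (fun y : M => dist y x₀) x)
    (V : M → ℝ) (hV : ContMDiff (𝓡 n) 𝓘(ℝ, ℝ) 1 V)
    (R c₀ α : ℝ) (hR : 0 < R) (hc₀ : 0 < c₀) (hα : 0 < α)
    (hVR : ∀ x ∈ (Metric.ball x₀ R)ᶜ, c₀ * dist x x₀ ^ α ≤ V x) :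
    RiemannianPole.IsSupersolutionOn (n := n) V (Metric.ball x₀ R)ᶜ
      (fun x : M => Real.exp (-(2 * Real.sqrt c₀ / (α + 2)) * dist x x₀ ^ (α / 2 + 1))) := by
  intro x hx
  obtain ⟨hD, hdD⟩ := RiemannianPole.contMDiff_dist_sq_of_isPole hpole
  have hRx : R ≤ dist x x₀ := by simpa using hx
  have hpos : 0 < dist x x₀ := hR.trans_le hRx
  have hsqrt : (fun x => Real.sqrt (0 + dist x x₀ ^ 2)) = fun x => dist x x₀ := by
    ext z
    rw [zero_add, Real.sqrt_sq dist_nonneg]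
  have hr2 : ContMDiffAt (𝓡 n) 𝓘(ℝ, ℝ) 2 (fun z => dist z x₀) x := by
    have h1 : ContDiffAt ℝ 2 (fun s : ℝ => Real.sqrt (0 + s)) (dist x x₀ ^ 2) :=
      (contDiffAt_const.add contDiffAt_id).sqrt (by simpa using hpos.ne')
    rw [← hsqrt]
    exact ContMDiffAt.comp (g := fun s : ℝ => Real.sqrt (0 + s)) x h1.contMDiffAt ((hD x).of_le ENat.LEInfty.out)
  have hdr : ∀ w : TangentSpace (𝓡 n) x,
      |RiemannianPole.dirDeriv (fun z => dist z x₀) x w| ≤ ‖w‖ := by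
    intro w
    have := RiemannianPole.abs_dirDeriv_sqrt_le hD (fun z w => by
      rw [Real.sqrt_sq dist_nonneg]
      exact hdD z w) le_rfl (x := x) (by positivity) w
    rwa [hsqrt] at this
  set a := 2 * Real.sqrt c₀ / (α + 2) with ha
  have hf := RiemannianPole.contDiffAt_exp_neg_mul_rpow a (α / 2 + 1) hpos
  refine ⟨ContMDiffAt.comp (g := fun s : ℝ => Real.exp (-a * s ^ (α / 2 + 1))) x
    hf.contMDiffAt hr2, ?_⟩
  obtain ⟨c, ⟨hc0, hc1⟩, hc⟩ := RiemannianPole.exists_laplaceBeltrami_comp_eq hr2 hdr hf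
  have hΔ := hr x (dist_pos.1 hpos)
  -- This is what fixes the constant `a`: the leading coefficient of `f''` becomes exactly `c₀`.
  have haβ : a * (α / 2 + 1) = Real.sqrt c₀ := by
    rw [ha]
    field_simp
  rw [RiemannianPole.deriv_deriv_exp_neg_mul_rpow _ _ hpos,
    (RiemannianPole.hasDerivAt_exp_neg_mul_rpow _ _ hpos).deriv, haβ, Real.sq_sqrt hc₀.le,
    show 2 * (α / 2 + 1 - 1) = α by ring] at hc
  rw [hc]
  have hz := Real.exp_pos (-a * dist x x₀ ^ (α / 2 + 1))
  have hA : 0 ≤ dist x x₀ ^ α := Real.rpow_nonneg hpos.le _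
  have hV1 := mul_le_mul_of_nonneg_right (hVR x hx) hz.le
  -- The bracket may have either sign: `c ≥ 0` discards its subtracted part, and `c ≤ 1` bounds the
  -- rest.
  have h1 : (c₀ * dist x x₀ ^ α - Real.sqrt c₀ * (α / 2 + 1 - 1) *
      dist x x₀ ^ (α / 2 + 1 - 1 - 1)) * c ≤ c₀ * dist x x₀ ^ α := by
    have hB : 0 ≤ Real.sqrt c₀ * (α / 2 + 1 - 1) * dist x x₀ ^ (α / 2 + 1 - 1 - 1) := by
      have : 0 ≤ α / 2 + 1 - 1 := by linarith
      positivity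
    have h2 := mul_nonneg hB hc0
    have h3 := mul_le_of_le_one_right (mul_nonneg hc₀.le hA) hc1
    linarith
  have h2 := mul_le_mul_of_nonneg_right h1 hz.le
  have h3 : 0 ≤ Real.sqrt c₀ * dist x x₀ ^ (α / 2 + 1 - 1) *
      Real.exp (-a * dist x x₀ ^ (α / 2 + 1)) *
        RiemannianPole.laplaceBeltrami (n := n) (fun y : M => dist y x₀) x := by positivity
  linarith
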